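/- Let $G=(V,E)$ be a finite simple graph. Its vertices are servers; each edge $e\in E$ carries a file $W_e\in\mathbb F_q^L$ ($L\ge 1$ sub-files, each a symbol of the finite field $\mathbb F_q$), which is stored exactly on the two endpoints of $e$. The files are independent and uniformly distributed. Write $\mathcal W_{S_i}$ for the collection of files stored on server $i$. A PIR scheme $\Pi$ over $G$ (with subpacketization $L$) consists, for every desired edge $\theta\in E$, of a random tuple of queries $(Q_i)_{i\in V}$, independent of the files. Here $Q_i$ is a finite list of $\mathbb F_q$-linear combinations of the sub-files stored on server $i$, and server $i$ answers with the list $A_i$ of their values. Two conditions are required: * (reliability) for every $\theta$, the file $W_\theta$ is recovered with zero probability of error from all the queries and answers; * (privacy) for every server $i$, the joint law of $(Q_i,A_i,\mathcal W_{S_i})$ does not depend on $\theta$. The rate of $\Pi$ is $R(\Pi)=L/\sum_{i\in V}H(A_i)$, where $H$ is the Shannon entropy with logarithms to base $q$ (by privacy, $H(A_i)$ does not depend on $\theta$). The capacity $\mathcal C_q(G)=\sup_\Pi R(\Pi)$ is the supremum over all $L\ge 1$ and all PIR schemes over $G$ with alphabet $\mathbb F_q$. (If $G$ has no edge, there is nothing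 to retrieve, and $\mathcal C_q(G)=\infty$ by convention.) Then there is a sequence of real numbers $(\varepsilon_N)_{N\ge 0}$ with $\varepsilon_N\to 0$ as $N\to\infty$ such that, for every finite field $\mathbb F_q$ and every finite simple graph $G$ with at least one vertex, $$\mathcal C_q(G)\ \ge\ \Bigl(\frac43-\varepsilon_{|G|}\Bigr)\cdot\frac1{|G|},$$ where $|G|=|V|$ is the number of vertices of $G$. -/

import Mathlib

/-! # Private information retrieval on a graph-based replication system

The vertices of a finite simple graph `G` are the servers.  Each edge `e` carries one file `W e`,
which consists of `L` sub-files, each of them a symbol of the finite field `F`; the file is stored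
on exactly the two endpoints of `e`. -/

namespace GraphPIR

universe u v

/-- The contents of all files: `W e l` is the `l`-th sub-file of the file of the edge `e`. -/
abbrev Files (F : Type v) {V : Type u} (G : SimpleGraph V) (L : ℕ) : Type (max u v) :=
  G.edgeSet → Fin L → F

/-- The contents of the files that are stored on the server `i`. -/
abbrev StoredFiles (F : Type v) {V : Type u} (G : SimpleGraph V) (L : ℕ) (i : V) :
    Type (max u v) :=
  G.incidenceSet i → Fin L → F

/-- The files stored on the server `i`, when the contents of all the files are `W`. -/
def stored {F : Type v} {V : Type u} {G : SimpleGraph V} {L : ℕ} (W : Files F G L) (i : V) :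
    StoredFiles F G L i :=
  fun e => W (Set.inclusion (G.incidenceSet_subset i) e)

/-- A query to the server `i`: a finite list of requested linear combinations, with coefficients
in `F`, of the sub-files of the files stored on `i`.  A linear combination is given as a linear
functional of the stored sub-files. -/
abbrev Query (F : Type v) [Field F] {V : Type u} (G : SimpleGraph V) (L : ℕ) (i : V) :
    Type (max u v) :=
  List (Module.Dual F (StoredFiles F G L i))

/-- One query for each server. -/
abbrev Queries (F : Type v) [Field F] {V : Type u} (G : SimpleGraph V) (L : ℕ) :
    Type (max u v) :=
  ∀ i : V, Query F G L i

/-- The answer of the server `i` to the query `q`: the values of the requested linear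
combinations.  It depends only on the query and on the files stored on `i`. -/
def answer {F : Type v} [Field F] {V : Type u} {G : SimpleGraph V} {L : ℕ} {i : V}
    (q : Query F G L i) (w : StoredFiles F G L i) : List F :=
  q.map fun c => c w

/-- The answers of all servers. -/
def answers {F : Type v} [Field F] {V : Type u} {G : SimpleGraph V} {L : ℕ}
    (q : Queries F G L) (W : Files F G L) : V → List F :=
  fun i => answer (q i) (stored W i)

/-- The law of the files: independent files, each uniformly distributed over `F ^ L`. -/
noncomputable def filesLaw (F : Type v) [Field F] [Fintype F] {V : Type u} [Fintype V]
    (G : SimpleGraph V) (L : ℕ) : PMF (Files F G L) :=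
  letI : Fintype (Files F G L) := Fintype.ofFinite _
  PMF.uniformOfFintype (Files F G L)

/-- The joint law of the queries and the files, when the queries have the law `Q`: the queries are
independent of the files. -/
noncomputable def jointLaw {F : Type v} [Field F] [Fintype F] {V : Type u} [Fintype V]
    {G : SimpleGraph V} {L : ℕ} (Q : PMF (Queries F G L)) :
    PMF (Queries F G L × Files F G L) :=
  Q.bind fun q => (filesLaw F G L).map fun W => (q, W)

/-- The Shannon entropy of a discrete distribution, with logarithms to the base `b`. -/
noncomputable def entropy (b : ℕ) {α : Type*} (p : PMF α) : ENNReal :=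
  ∑' a, ENNReal.ofReal (Real.negMulLog (p a).toReal / Real.log b)

/-- A PIR scheme over `G`, with files of `L` symbols of `F`. -/
structure Scheme (F : Type v) [Field F] [Fintype F] {V : Type u} [Fintype V]
    (G : SimpleGraph V) where
  /-- The subpacketization. -/
  L : ℕ
  L_pos : 0 < L
  /-- The joint law of the queries to all servers, when the file of the edge `θ` is desired.  The
  private randomness of the user (permutations of sub-files, random choices) is in this law. -/
  queryLaw : G.edgeSet → PMF (Queries F G L)
  /-- The desired file is recovered, with probability one, from the queries and the answers. -/
  reliable : ∀ θ : G.edgeSet, ∃ decode : Queries F G L → (V → List F) → (Fin L → F),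
    ∀ x ∈ (jointLaw (queryLaw θ)).support, decode x.1 (answers x.1 x.2) = x.2 θ
  /-- For every server, the joint law of its query, its answer and its stored files does not depend
  on which file is desired. -/
  private_law : ∀ (i : V) (θ θ' : G.edgeSet),
    (jointLaw (queryLaw θ)).map (fun x => (x.1 i, answers x.1 x.2 i, stored x.2 i)) =
      (jointLaw (queryLaw θ')).map (fun x => (x.1 i, answers x.1 x.2 i, stored x.2 i))

/-- The law of the answer of the server `i`, when the file of the edge `θ` is desired. -/
noncomputable def Scheme.answerLaw {F : Type v} [Field F] [Fintype F] {V : Type u} [Fintype V]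
    {G : SimpleGraph V} (S : Scheme F G) (θ : G.edgeSet) (i : V) : PMF (List F) :=
  (jointLaw (S.queryLaw θ)).map fun x => answers x.1 x.2 i

/-- The retrieval rate `L / ∑ i, H(A i)`, with entropies in units of one symbol of `F`, so that a
file has entropy `L`.  By privacy the sum of the entropies is the same for all desired files `θ`,
hence the supremum over `θ` is this common value. -/
noncomputable def Scheme.rate {F : Type v} [Field F] [Fintype F] {V : Type u} [Fintype V]
    {G : SimpleGraph V} (S : Scheme F G) : ENNReal :=
  (S.L : ENNReal) / ⨆ θ : G.edgeSet, ∑ i : V, entropy (Fintype.card F) (S.answerLaw θ i)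

/-- The PIR capacity of `G` over the alphabet `F`: the supremum of the rates of all PIR schemes. -/
noncomputable def capacity (F : Type v) [Field F] [Fintype F] {V : Type u} [Fintype V]
    (G : SimpleGraph V) : ENNReal :=
  ⨆ S : Scheme F G, S.rate

end GraphPIR

/-! The bound holds with `ε = 0`. With n = |V|, sub-files of e are labelled by f : V → ZMod 3
nonzero on e, so L = 8·3^(n-2). Server i returns one symbol for each g with g i ≠ 0: the signed sum
of the sub-files labelled g on edges ij with g j ≠ 0. This downloads 2n·3^(n-1) symbols, giving rate
4/(3n). Signs are antisymmetric, so adding the symbols for one label cancels every edge. For a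
desired edge θ = ab, the endpoints permute their labels by `twist`: other edges still cancel, but
each sub-file of θ is now requested by exactly one of a, b and survives (`sgn_sum_ne_zero`,
`sum_answers`). Labels are assigned uniformly at random, so a permutation of them is invisible to a
single server (`map_uniformOfFintype_equiv`). -/

namespace GraphPIR

/-! ### Uniform laws and entropy bounds. -/

/-- The image of a uniform law under a bijection is uniform. -/
theorem map_uniformOfFintype_equiv {α : Type*} [Fintype α] [Nonempty α] (e : α ≃ α) :
    (PMF.uniformOfFintype α).map e = PMF.uniformOfFintype α := by
  classical
  ext b
  rw [PMF.map_apply, tsum_eq_single (e.symm b)]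
  · simp
  · intro a ha
    rw [if_neg]
    rintro rfl
    simp at ha

/-- The entropy of a distribution with finite support is at most the logarithm of the size of
the support. -/
theorem entropy_le_log_card {α : Type*} (b : ℕ) (hb : 1 < b) (p : PMF α) (s : Finset α)
    (hs : ∀ a ∈ p.support, a ∈ s) :
    entropy b p ≤ ENNReal.ofReal (Real.log s.card / Real.log b) := by
  have hlog : 0 < Real.log b := Real.log_pos (by exact_mod_cast hb)
  have h0 : ∀ a ∉ s, p a = 0 := fun a ha => by
    by_contra h
    exact ha (hs a ((p.mem_support_iff a).2 h))
  have hsum : ∑ a ∈ s, (p a).toReal = 1 := by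
    rw [← ENNReal.toReal_sum fun a _ => p.apply_ne_top a, ← tsum_eq_sum (L := .unconditional α) fun a ha => h0 a ha,
      p.tsum_coe, ENNReal.toReal_one]
  have hne : s.Nonempty := by
    by_contra h
    rw [Finset.not_nonempty_iff_eq_empty] at h
    simp [h] at hsum
  have hcard : (0 : ℝ) < s.card := by exact_mod_cast hne.card_pos
  have hp1 : ∀ a, (p a).toReal ≤ 1 := fun a =>
    ENNReal.toReal_le_of_le_ofReal zero_le_one (by simpa using p.coe_le_one a)
  rw [entropy, tsum_eq_sum (s := s) (fun a ha => by simp [h0 a ha]),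
    ← ENNReal.ofReal_sum_of_nonneg fun a _ =>
      div_nonneg (Real.negMulLog_nonneg ENNReal.toReal_nonneg (hp1 a)) hlog.le]
  refine ENNReal.ofReal_le_ofReal ?_
  rw [← Finset.sum_div]
  refine div_le_div_of_nonneg_right ?_ hlog.le
  -- Gibbs' inequality: log t ≤ t - 1 at t = 1 / (p a · |s|); the corrections sum to zero over `s`.
  have key : ∀ a ∈ s, Real.negMulLog (p a).toReal ≤
      (p a).toReal * Real.log s.card + ((s.card : ℝ)⁻¹ - (p a).toReal) := by
    intro a _
    rcases (ENNReal.toReal_nonneg (a := p a)).eq_or_lt with h | h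
    · rw [← h]; simp
    · have h1 := Real.log_le_sub_one_of_pos (inv_pos.2 (mul_pos h hcard))
      rw [Real.log_inv, Real.log_mul h.ne' hcard.ne'] at h1
      have h2 := mul_le_mul_of_nonneg_left h1 h.le
      have h3 : (p a).toReal * (((p a).toReal * s.card)⁻¹ - 1) =
          (s.card : ℝ)⁻¹ - (p a).toReal := by
        field_simp
      rw [Real.negMulLog]
      linarith
  refine (Finset.sum_le_sum key).trans (le_of_eq ?_)
  rw [Finset.sum_add_distrib, ← Finset.sum_mul, hsum, Finset.sum_sub_distrib, hsum,
    Finset.sum_const, nsmul_eq_mul, mul_inv_cancel₀ hcard.ne']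
  ring

/-- A random list of fixed length over an alphabet `F` has entropy at most its length. -/
theorem entropy_le_length {F : Type*} [Fintype F] (hF : 1 < Fintype.card F) (n : ℕ)
    (p : PMF (List F)) (hp : ∀ l ∈ p.support, l.length = n) :
    entropy (Fintype.card F) p ≤ n := by
  classical
  have hlog : 0 < Real.log (Fintype.card F) := Real.log_pos (by exact_mod_cast hF)
  refine (entropy_le_log_card _ hF p
    ((Finset.univ : Finset (Fin n → F)).image List.ofFn) fun l hl => ?_).trans ?_
  · refine Finset.mem_image.2 ⟨fun k => l.get (k.cast (hp l hl).symm), Finset.mem_univ _, ?_⟩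
    have := hp l hl
    subst this
    simp
  · rw [Finset.card_image_of_injective _ List.ofFn_injective, Finset.card_univ, Fintype.card_fun,
      Fintype.card_fin, Nat.cast_pow, Real.log_pow, mul_div_assoc, div_self hlog.ne', mul_one,
      ENNReal.ofReal_natCast]

/-! ### Reduction of privacy and reliability to the queries. -/

section Law

variable {F : Type*} [Field F] [Fintype F] {V : Type*} [Fintype V] {G : SimpleGraph V} {L : ℕ}

theorem fst_mem_support_of_mem_jointLaw {Q : PMF (Queries F G L)}
    {x : Queries F G L × Files F G L} (hx : x ∈ (jointLaw Q).support) : x.1 ∈ Q.support := by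
  rw [jointLaw, PMF.mem_support_bind_iff] at hx
  obtain ⟨q, hq, hx⟩ := hx
  rw [PMF.mem_support_map_iff] at hx
  obtain ⟨W, -, rfl⟩ := hx
  exact hq

/-- Privacy of the queries implies privacy of the joint law of query, answer and stored files. -/
theorem map_jointLaw_eq_of_map_eq {Q Q' : PMF (Queries F G L)} (i : V)
    (h : Q.map (fun q => q i) = Q'.map (fun q => q i)) :
    (jointLaw Q).map (fun x => (x.1 i, answers x.1 x.2 i, stored x.2 i)) =
      (jointLaw Q').map (fun x => (x.1 i, answers x.1 x.2 i, stored x.2 i)) := by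
  have key : ∀ Q : PMF (Queries F G L),
      (jointLaw Q).map (fun x => (x.1 i, answers x.1 x.2 i, stored x.2 i)) =
        (Q.map (fun q => q i)).bind fun c => (filesLaw F G L).map
          fun W => (c, answer c (stored W i), stored W i) := by
    intro Q
    rw [jointLaw, PMF.map_bind, PMF.bind_map]
    congr 1
    funext q
    rw [PMF.map_comp]
    rfl
  rw [key, key, h]

/-- A decoder exists as soon as the queries and the answers determine the desired file. -/
theorem exists_decode (Q : PMF (Queries F G L)) (θ : G.edgeSet)
    (h : ∀ q ∈ Q.support, ∀ W W' : Files F G L, answers q W = answers q W' → W θ = W' θ) :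
    ∃ decode : Queries F G L → (V → List F) → (Fin L → F),
      ∀ x ∈ (jointLaw Q).support, decode x.1 (answers x.1 x.2) = x.2 θ := by
  classical
  -- Any file assignment consistent with the answers will do; the default 0 is never reached on
  -- actual answers.
  refine ⟨fun q A => if h : ∃ W, answers q W = A then h.choose θ else 0, fun x hx => ?_⟩
  have hW : ∃ W, answers x.1 W = answers x.1 x.2 := ⟨_, rfl⟩
  beta_reduce
  rw [dif_pos hW]
  exact h x.1 (fst_mem_support_of_mem_jointLaw hx) _ _ hW.choose_spec

end Law

/-! ### Labels in ZMod 3 and the twist. -/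

section Construction

variable {V : Type*} [LinearOrder V]

/-- An antisymmetric sign. -/
def sgn (R : Type*) [Ring R] (i j : V) : R := if i < j then 1 else -1

theorem sgn_swap (R : Type*) [Ring R] {i j : V} (h : i ≠ j) : sgn R j i = -sgn R i j := by
  rcases h.lt_or_gt with h | h <;> simp [sgn, h, h.not_gt]

theorem sgn_ne_zero (R : Type*) [Ring R] [Nontrivial R] (i j : V) : sgn R i j ≠ 0 := by
  unfold sgn
  split_ifs <;> simp

/-- The sub-files of the edge `e` are labelled by the functions `V → ZMod 3` that do not vanish
on `e`. -/
abbrev Label (e : Sym2 V) : Type _ := {f : V → ZMod 3 // ∃ v ∈ e, f v ≠ 0}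

theorem card_label [Fintype V] (e : Sym2 V) (he : ¬ e.IsDiag) :
    Fintype.card (Label e) = 8 * 3 ^ (Fintype.card V - 2) := by
  induction e using Sym2.ind with | _ a b
  rw [Sym2.mk_isDiag_iff] at he
  have h2 : 2 ≤ Fintype.card V := by
    have := Finset.card_le_univ ({a, b} : Finset V)
    rwa [Finset.card_pair he] at this
  -- Count the complement: functions vanishing at both endpoints.
  have hz : Fintype.card {f : V → ZMod 3 // ¬ ∃ v ∈ s(a, b), f v ≠ 0} =
      3 ^ (Fintype.card V - 2) := by
    have : (Finset.univ.filter fun f : V → ZMod 3 => ¬ ∃ v ∈ s(a, b), f v ≠ 0) =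
        Fintype.piFinset fun v => if v ∈ ({a, b} : Finset V) then {0} else Finset.univ := by
      ext f
      simp only [Finset.mem_filter, Finset.mem_univ, true_and, Fintype.mem_piFinset]
      push Not
      refine forall_congr' fun v => ?_
      by_cases hv : v ∈ s(a, b)
      · have hv' : v ∈ ({a, b} : Finset V) := by simpa using hv
        simp [hv, hv', -Sym2.mem_iff, -Finset.mem_insert]
      · have hv' : v ∉ ({a, b} : Finset V) := by simpa using hv
        simp [hv, hv', -Sym2.mem_iff, -Finset.mem_insert]
    rw [Fintype.card_subtype, this, Fintype.card_piFinset]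
    have : ∀ v : V, (if v ∈ ({a, b} : Finset V) then ({0} : Finset (ZMod 3)) else
        Finset.univ).card = if v ∈ ({a, b} : Finset V) then 1 else 3 := fun v => by
      split_ifs <;> simp
    simp_rw [this]
    rw [Finset.prod_ite]
    simp only [Finset.prod_const_one, one_mul, Finset.prod_const]
    congr 1
    rw [Finset.filter_not, Finset.filter_mem_eq_inter, Finset.univ_inter,
      Finset.card_sdiff_of_subset (Finset.subset_univ _), Finset.card_pair he, Finset.card_univ]
  have hall : Fintype.card (V → ZMod 3) = 9 * 3 ^ (Fintype.card V - 2) := by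
    rw [Fintype.card_fun, ZMod.card]
    conv_lhs => rw [← Nat.sub_add_cancel h2, pow_add]
    ring
  have := Fintype.card_subtype_compl (fun f : V → ZMod 3 => ∃ v ∈ s(a, b), f v ≠ 0)
  rw [hz, hall] at this
  have hle := Fintype.card_subtype_le (fun f : V → ZMod 3 => ∃ v ∈ s(a, b), f v ≠ 0)
  rw [hall] at hle
  have hpos : 0 < 3 ^ (Fintype.card V - 2) := by positivity
  change Fintype.card {f : V → ZMod 3 // ∃ v ∈ s(a, b), f v ≠ 0} = _
  omega

/-- The positions of the answers in the list that the server `i` returns. -/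
abbrev Position (i : V) : Type _ := {g : V → ZMod 3 // g i ≠ 0}

theorem card_position [Fintype V] (i : V) :
    Fintype.card (Position i) = 2 * 3 ^ (Fintype.card V - 1) := by
  have : (Finset.univ.filter fun f : V → ZMod 3 => f i ≠ 0) =
      Fintype.piFinset fun v => if v = i then {0}ᶜ else Finset.univ := by
    ext f
    simp only [Finset.mem_filter, Finset.mem_univ, true_and, Fintype.mem_piFinset]
    constructor
    · intro h v
      split_ifs with hv
      · subst hv; simpa using h
      · simp
    · intro h
      simpa using h i
  rw [Fintype.card_subtype, this, Fintype.card_piFinset,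
    ← Finset.mul_prod_erase _ _ (Finset.mem_univ i),
    Finset.prod_congr rfl fun v hv => by rw [if_neg (Finset.ne_of_mem_erase hv)]]
  simp [Finset.card_compl, ZMod.card]

/-- The involution of the labels that hides from the server `i` that the edge `θ` is desired. -/
def twistFun (θ : Sym2 V) (i : V) (g : V → ZMod 3) : V → ZMod 3 :=
  -- Only the endpoints of θ twist, each changing the coordinate of the other endpoint.
  fun k => if s(i, k) = θ then sgn (ZMod 3) i k * g i - g k else g k

theorem twistFun_self {θ : Sym2 V} (hθ : ¬ θ.IsDiag) (i : V) (g : V → ZMod 3) :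
    twistFun θ i g i = g i :=
  if_neg fun h : s(i, i) = θ => hθ (h ▸ Sym2.mk_isDiag_iff.2 rfl)

theorem twistFun_of_ne {θ : Sym2 V} {i k : V} (h : s(i, k) ≠ θ) (g : V → ZMod 3) :
    twistFun θ i g k = g k :=
  if_neg h

theorem twistFun_involutive {θ : Sym2 V} (hθ : ¬ θ.IsDiag) (i : V) :
    Function.Involutive (twistFun θ i) := by
  intro g
  funext k
  have hi := twistFun_self hθ i g
  by_cases h : s(i, k) = θ
  · rw [twistFun, if_pos h, hi, twistFun, if_pos h]
    ring
  · rw [twistFun_of_ne h, twistFun_of_ne h]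

/-- `twistFun` as a permutation. -/
def twist {θ : Sym2 V} (hθ : ¬ θ.IsDiag) (i : V) : Equiv.Perm (V → ZMod 3) :=
  (twistFun_involutive hθ i).toPerm

theorem twist_apply {θ : Sym2 V} (hθ : ¬ θ.IsDiag) (i : V) (g : V → ZMod 3) :
    twist hθ i g = twistFun θ i g := rfl

/-- The twist fixes coordinate i and, when that is zero, can only negate the other one. -/
theorem exists_mem_twist_ne_zero_iff {θ e : Sym2 V} (hθ : ¬ θ.IsDiag) {i : V} (hi : i ∈ e)
    (f : V → ZMod 3) : (∃ v ∈ e, f v ≠ 0) ↔ ∃ v ∈ e, twist hθ i f v ≠ 0 := by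
  obtain ⟨k, rfl⟩ := hi
  simp only [Sym2.mem_iff, exists_eq_or_imp, exists_eq_left, twist_apply, twistFun_self hθ]
  by_cases h0 : f i = 0
  · simp only [h0, ne_eq, not_true_eq_false, false_or]
    by_cases h : s(i, k) = θ
    · simp [twistFun, h, h0]
    · rw [twistFun_of_ne h]
  · simp [h0]

/-- Exactly one of the endpoints of the desired edge requests a given sub-file. -/
theorem sgn_sum_ne_zero (F : Type*) [Field F] {a b : V} (hab : a ≠ b) (f : V → ZMod 3)
    (hf : ∃ v ∈ s(a, b), f v ≠ 0) :
    (if f a ≠ 0 ∧ twistFun s(a, b) a f b ≠ 0 then sgn F a b else 0) +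
      (if f b ≠ 0 ∧ twistFun s(a, b) b f a ≠ 0 then sgn F b a else 0) ≠ 0 := by
  have h1 : twistFun s(a, b) a f b = sgn (ZMod 3) a b * f a - f b := if_pos rfl
  have h2 : twistFun s(a, b) b f a = sgn (ZMod 3) b a * f b - f a := if_pos Sym2.eq_swap
  rw [h1, h2, sgn_swap (ZMod 3) hab]
  simp only [Sym2.mem_iff, exists_eq_or_imp, exists_eq_left] at hf
  -- The opposite signs `s` and `-s` are essential: with equal signs both endpoints would test x ≠
  -- ±y alike.
  have key : ∀ s x y : ZMod 3, (s = 1 ∨ s = -1) → (x ≠ 0 ∨ y ≠ 0) →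
      ((x ≠ 0 ∧ s * x - y ≠ 0) ↔ ¬ (y ≠ 0 ∧ -s * y - x ≠ 0)) := by decide
  have hs : sgn (ZMod 3) a b = 1 ∨ sgn (ZMod 3) a b = -1 := by
    unfold sgn
    split_ifs <;> simp
  have := key _ _ _ hs hf
  by_cases h : f b ≠ 0 ∧ -sgn (ZMod 3) a b * f b - f a ≠ 0
  · rw [if_neg (fun h' => this.1 h' h), if_pos h, zero_add]
    exact sgn_ne_zero F b a
  · rw [if_pos (this.2 h), if_neg h, add_zero]
    exact sgn_ne_zero F a b

end Construction

/-! ### The scheme, its decoding, privacy and rate. -/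

section Scheme

variable {F : Type*} [Field F] {V : Type*} [Fintype V] [LinearOrder V] {G : SimpleGraph V} {L : ℕ}

/-- An enumeration of the sub-files of each file by the labels of its edge. -/
abbrev Labelling (G : SimpleGraph V) (L : ℕ) : Type _ := ∀ e : G.edgeSet, Label e.1 ≃ Fin L

/-- The functional that reads one sub-file of a stored file. -/
def coord {i : V} (e : G.incidenceSet i) (l : Fin L) : Module.Dual F (StoredFiles F G L i) where
  toFun w := w e l
  map_add' _ _ := rfl
  map_smul' _ _ := rfl

open scoped Classical in
/-- The linear combination that the server `i` returns at the position `g`: it involves one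
sub-file for each neighbour on which `g` does not vanish. -/
noncomputable def form (i : V) (π : Labelling G L) (g : Position i) :
    Module.Dual F (StoredFiles F G L i) :=
  ∑ j, if h : G.Adj i j ∧ g.1 j ≠ 0 then
    sgn F i j • coord ⟨s(i, j), h.1, Sym2.mem_mk_left i j⟩
      (π ⟨s(i, j), h.1⟩ ⟨g.1, i, Sym2.mem_mk_left i j, g.2⟩)
  else 0

/-- The query to the server `i`, for a given enumeration of the sub-files. -/
noncomputable def labelledQuery (F : Type*) [Field F] (i : V) (π : Labelling G L) :
    Query F G L i :=
  (Finset.univ : Finset (Position i)).toList.map (form i π)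

open scoped Classical in
/-- The bijection of the enumerations induced by `twist`. -/
noncomputable def relabel {θ : Sym2 V} (hθ : ¬ θ.IsDiag) (i : V) :
    Labelling G L ≃ Labelling G L :=
  Equiv.piCongrRight fun e =>
    -- The test can fail only on edges avoiding i, which server i never reads.
    if h : ∀ f : V → ZMod 3, (∃ v ∈ e.1, f v ≠ 0) ↔ ∃ v ∈ e.1, twist hθ i f v ≠ 0 then
      Equiv.equivCongr ((twist hθ i).subtypeEquiv h).symm (Equiv.refl _)
    else Equiv.refl _

theorem relabel_apply {θ : Sym2 V} (hθ : ¬ θ.IsDiag) {i : V} (π : Labelling G L) (e : G.edgeSet)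
    (hi : i ∈ e.1) (f g : Label e.1) (hfg : twistFun θ i f.1 = g.1) :
    relabel hθ i π e f = π e g := by
  have h : ∀ f : V → ZMod 3, (∃ v ∈ e.1, f v ≠ 0) ↔ ∃ v ∈ e.1, twist hθ i f v ≠ 0 :=
    exists_mem_twist_ne_zero_iff hθ hi
  simp only [relabel, Equiv.piCongrRight_apply, Pi.map_apply, dif_pos h]
  exact congrArg (π e) (Subtype.ext hfg)

/-- The queries to all servers, when the file of `θ` is desired. -/
noncomputable def twistedQueries (F : Type*) [Field F] {θ : Sym2 V} (hθ : ¬ θ.IsDiag)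
    (π : Labelling G L) : Queries F G L :=
  fun i => labelledQuery F i (relabel hθ i π)

theorem length_answers_twistedQueries {θ : Sym2 V} (hθ : ¬ θ.IsDiag) (π : Labelling G L)
    (W : Files F G L) (i : V) :
    (answers (twistedQueries F hθ π) W i).length = 2 * 3 ^ (Fintype.card V - 1) := by
  simp only [answers, answer, twistedQueries, labelledQuery, List.length_map,
    Finset.length_toList, Finset.card_univ, ← card_position i]

open scoped Classical in
/-- The sub-file of `e` with label `f`. -/
noncomputable def subfile (W : Files F G L) (π : Labelling G L) (f : V → ZMod 3) (e : Sym2 V) :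
    F :=
  if h : e ∈ G.edgeSet ∧ ∃ v ∈ e, f v ≠ 0 then W ⟨e, h.1⟩ (π ⟨e, h.1⟩ ⟨f, h.2⟩) else 0

/-- The twist is an involution, so the position holding the sub-files labelled f is the twist of f.
-/
theorem form_relabel_apply {θ : Sym2 V} (hθ : ¬ θ.IsDiag) (π : Labelling G L) (W : Files F G L)
    (f : V → ZMod 3) {i : V} (hi : f i ≠ 0) :
    form i (relabel hθ i π) ⟨twistFun θ i f, by rwa [twistFun_self hθ]⟩ (stored W i) =
      ∑ j, if twistFun θ i f j ≠ 0 then sgn F i j * subfile W π f s(i, j) else 0 := by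
  rw [form, LinearMap.sum_apply]
  refine Finset.sum_congr rfl fun j _ => ?_
  by_cases hj : twistFun θ i f j ≠ 0
  · by_cases h : G.Adj i j
    · rw [dif_pos ⟨h, hj⟩, if_pos hj, subfile, dif_pos ⟨h, i, Sym2.mem_mk_left i j, hi⟩,
        relabel_apply hθ π _ (Sym2.mem_mk_left i j) _ ⟨f, i, Sym2.mem_mk_left i j, hi⟩
          (twistFun_involutive hθ i f)]
      rfl
    · rw [dif_neg (fun h' => h h'.1), if_pos hj, subfile, dif_neg (fun h' => h h'.1)]
      simp
  · rw [dif_neg (fun h' => hj h'.2), if_neg hj]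
    rfl

/-- In the sum of the answers of all servers that use the label `f`, everything cancels except
for one sub-file of the desired file. -/
theorem sum_answers {a b : V} (hab : a ≠ b) (π : Labelling G L) (W : Files F G L)
    (f : V → ZMod 3) :
    (∑ i, if f i ≠ 0 then
      ∑ j, if twistFun s(a, b) i f j ≠ 0 then sgn F i j * subfile W π f s(i, j) else 0 else 0) =
    ((if f a ≠ 0 ∧ twistFun s(a, b) a f b ≠ 0 then sgn F a b else 0) +
      (if f b ≠ 0 ∧ twistFun s(a, b) b f a ≠ 0 then sgn F b a else 0)) *
      subfile W π f s(a, b) := by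
  set M : V × V → F := fun p =>
    if f p.1 ≠ 0 ∧ twistFun s(a, b) p.1 f p.2 ≠ 0 then
      sgn F p.1 p.2 * subfile W π f s(p.1, p.2) else 0 with hM
  have hdiag : ∀ i, M (i, i) = 0 := fun i => by
    simp [hM, subfile]
  have h1 : (∑ i, if f i ≠ 0 then
      ∑ j, if twistFun s(a, b) i f j ≠ 0 then sgn F i j * subfile W π f s(i, j) else 0 else 0) =
      ∑ p, M p := by
    rw [Fintype.sum_prod_type]
    refine Finset.sum_congr rfl fun i _ => ?_
    by_cases hi : f i ≠ 0
    · simp [hM, hi]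
    · simp [hM, hi]
  -- Away from θ the twist is trivial, so (i, j) and (j, i) contribute opposite terms.
  have h0 : ∑ p with s(p.1, p.2) ≠ s(a, b), M p = 0 := by
    refine Finset.sum_involution (fun p _ => p.swap) ?_ ?_ ?_ ?_
    · rintro ⟨i, j⟩ hp
      have hp : s(i, j) ≠ s(a, b) := by simpa using hp
      have hp' : s(j, i) ≠ s(a, b) := by rwa [Sym2.eq_swap]
      by_cases hij : i = j
      · subst hij
        simp [hdiag]
      · simp only [hM, Prod.swap, twistFun_of_ne hp, twistFun_of_ne hp', sgn_swap F hij,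
          Sym2.eq_swap (a := j) (b := i)]
        by_cases hi : f i = 0 <;> by_cases hj : f j = 0 <;> simp [hi, hj]
    · rintro ⟨i, j⟩ _ hne heq
      obtain rfl : j = i := congrArg Prod.fst heq
      exact hne (hdiag j)
    · rintro ⟨i, j⟩ hp
      have hp : s(i, j) ≠ s(a, b) := by simpa using hp
      rw [Sym2.eq_swap] at hp
      exact Finset.mem_filter.2 ⟨Finset.mem_univ _, hp⟩
    · rintro ⟨i, j⟩ _
      rfl
  have h2 : (Finset.univ.filter fun p : V × V => ¬ s(p.1, p.2) ≠ s(a, b)) =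
      {(a, b), (b, a)} := by
    ext ⟨i, j⟩
    rw [Finset.mem_filter, not_not, Sym2.eq_iff]
    simp
  rw [h1, ← Finset.sum_filter_add_sum_filter_not _ (fun p : V × V => s(p.1, p.2) ≠ s(a, b)), h0,
    h2, Finset.sum_pair (by simp [hab]), zero_add, add_mul]
  simp only [hM, Sym2.eq_swap (a := b) (b := a), ite_mul, zero_mul]

/-- The queries and the answers determine the desired file. -/
theorem eq_of_answers_eq (θ : G.edgeSet) (hθ : ¬ θ.1.IsDiag) (π : Labelling G L)
    (W W' : Files F G L)
    (h : answers (twistedQueries F hθ π) W = answers (twistedQueries F hθ π) W') :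
    W θ = W' θ := by
  obtain ⟨θ, hmem⟩ := θ
  induction θ using Sym2.ind with | _ a b
  have hab : a ≠ b := fun h => hθ (Sym2.mk_isDiag_iff.2 h)
  funext l
  obtain ⟨⟨f, hf⟩, rfl⟩ := (π ⟨s(a, b), hmem⟩).surjective l
  have hans : ∀ i (g : Position i), form i (relabel hθ i π) g (stored W i) =
      form i (relabel hθ i π) g (stored W' i) := by
    intro i g
    have hi := congrFun h i
    simp only [answers, answer, twistedQueries, labelledQuery, List.map_map] at hi
    exact List.map_inj_left.1 hi g (by simp)
  have key : subfile W π f s(a, b) = subfile W' π f s(a, b) := by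
    refine mul_left_cancel₀ (sgn_sum_ne_zero F hab f hf) ?_
    rw [← sum_answers hab, ← sum_answers hab]
    refine Finset.sum_congr rfl fun i _ => ?_
    split_ifs with hi
    · rw [← form_relabel_apply hθ π W f hi, ← form_relabel_apply hθ π W' f hi, hans]
    · rfl
  rwa [subfile, dif_pos ⟨hmem, hf⟩, subfile, dif_pos ⟨hmem, hf⟩] at key

theorem nonempty_labelling (G : SimpleGraph V) :
    Nonempty (Labelling G (8 * 3 ^ (Fintype.card V - 2))) :=
  ⟨fun e => Fintype.equivFinOfCardEq (card_label e.1 (G.not_isDiag_of_mem_edgeSet e.2))⟩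

open scoped Classical in
/-- The scheme: the enumerations of the sub-files are independent and uniformly random. -/
noncomputable def twistedScheme (F : Type*) [Field F] [Fintype F] (G : SimpleGraph V) :
    Scheme F G :=
  haveI := nonempty_labelling G
  { L := 8 * 3 ^ (Fintype.card V - 2)
    L_pos := by positivity
    queryLaw := fun θ => (PMF.uniformOfFintype (Labelling G _)).map
      (twistedQueries F (G.not_isDiag_of_mem_edgeSet θ.2))
    reliable := fun θ => exists_decode _ θ fun q hq W W' h => by
      obtain ⟨π, -, rfl⟩ := (PMF.mem_support_map_iff _ _ _).1 hq
      exact eq_of_answers_eq θ _ π W W' h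
    private_law := fun i θ θ' => by
      have key : ∀ θ : G.edgeSet,
          ((PMF.uniformOfFintype (Labelling G (8 * 3 ^ (Fintype.card V - 2)))).map
            (twistedQueries F (G.not_isDiag_of_mem_edgeSet θ.2))).map (fun q => q i) =
          (PMF.uniformOfFintype (Labelling G _)).map (labelledQuery F i) := by
        intro θ
        rw [PMF.map_comp]
        -- The uniform law absorbs the bijection `relabel`, which carries all dependence on θ.
        conv_rhs =>
          rw [← map_uniformOfFintype_equiv (relabel (G.not_isDiag_of_mem_edgeSet θ.2) i),
            PMF.map_comp]
        rfl
      exact map_jointLaw_eq_of_map_eq i ((key θ).trans (key θ').symm) }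

theorem entropy_answerLaw_twistedScheme_le (F : Type*) [Field F] [Fintype F] (G : SimpleGraph V)
    (θ : G.edgeSet) (i : V) :
    entropy (Fintype.card F) ((twistedScheme F G).answerLaw θ i) ≤
      (2 * 3 ^ (Fintype.card V - 1) : ℕ) := by
  refine entropy_le_length Fintype.one_lt_card _ _ fun l hl => ?_
  obtain ⟨x, hx, rfl⟩ := (PMF.mem_support_map_iff _ _ _).1 hl
  obtain ⟨π, -, hπ⟩ := (PMF.mem_support_map_iff _ _ _).1 (fst_mem_support_of_mem_jointLaw hx)
  rw [← hπ]
  exact length_answers_twistedQueries _ π x.2 i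

theorem le_rate_twistedScheme (F : Type*) [Field F] [Fintype F] (G : SimpleGraph V) :
    ENNReal.ofReal (4 / 3 * (1 / (Fintype.card V : ℝ))) ≤ (twistedScheme F G).rate := by
  have hL : (twistedScheme F G).L = 8 * 3 ^ (Fintype.card V - 2) := rfl
  rw [Scheme.rate, hL]
  rcases isEmpty_or_nonempty G.edgeSet with hE | ⟨⟨θ⟩⟩
  -- Without edges the supremum is 0 and the rate is infinite.
  · rw [iSup_of_empty, bot_eq_zero, ENNReal.div_zero (by simp)]
    exact le_top
  -- An edge needs two vertices, so the truncated exponent n - 2 is exact.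
  · have h2 : 2 ≤ Fintype.card V := by
      obtain ⟨e, he⟩ := θ
      induction e using Sym2.ind with | _ a b
      have := Finset.card_le_univ ({a, b} : Finset V)
      rwa [Finset.card_pair (G.ne_of_adj he)] at this
    have hsup : (⨆ θ : G.edgeSet, ∑ i : V,
        entropy (Fintype.card F) ((twistedScheme F G).answerLaw θ i)) ≤
        (Fintype.card V * (2 * 3 ^ (Fintype.card V - 1)) : ℕ) := by
      refine iSup_le fun θ => (Finset.sum_le_sum fun i _ =>
        entropy_answerLaw_twistedScheme_le F G θ i).trans (le_of_eq ?_)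
      rw [Finset.sum_const, nsmul_eq_mul, Finset.card_univ]
      push_cast
      ring
    refine le_trans (le_of_eq ?_) (ENNReal.div_le_div_left hsup _)
    obtain ⟨n, hn⟩ := Nat.exists_eq_add_of_le h2
    have hn1 : Fintype.card V - 1 = n + 1 := by omega
    have hn2 : Fintype.card V - 2 = n := by omega
    rw [hn1, hn2, ← ENNReal.ofReal_natCast, ← ENNReal.ofReal_natCast,
      ← ENNReal.ofReal_div_of_pos (by positivity)]
    congr 1
    have : (Fintype.card V : ℝ) ≠ 0 := by positivity
    push_cast
    field_simp
    ring

end Scheme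

end GraphPIR

theorem mainTheorem4 :
    ∃ ε : ℕ → ℝ, Filter.Tendsto ε Filter.atTop (nhds 0) ∧
      ∀ (F : Type*) [Field F] [Fintype F] (V : Type*) [Fintype V] (G : SimpleGraph V),
        ENNReal.ofReal ((4 / 3 - ε (Fintype.card V)) * (1 / (Fintype.card V : ℝ))) ≤
          GraphPIR.capacity F G := by
  refine ⟨fun _ => 0, tendsto_const_nhds, ?_⟩
  intro F _ _ V _ G
  let _ : LinearOrder V :=
    LinearOrder.lift' (Fintype.equivFin V) (Fintype.equivFin V).injective
  rw [sub_zero]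
  exact (GraphPIR.le_rate_twistedScheme F G).trans
    (le_iSup GraphPIR.Scheme.rate (GraphPIR.twistedScheme F G))
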